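/- Let $\mathbb B(\mathbb Z^2)$ be the set of (unoriented) nearest-neighbour edges of $\mathbb Z^2$. Call a probability law $\mathbb P$ on $(0,\infty)^{\mathbb B(\mathbb Z^2)}$ (with the product $\sigma$-algebra) admissible if it is stationary and ergodic with respect to the translations of $\mathbb Z^2$ and, for each edge $e$, the law of the weight $w(e)$ under $\mathbb P$ has compact support in $(0,\infty)$. The dual lattice has vertices $x^\star=x+(\tfrac12,\tfrac12)$, $x\in\mathbb Z^2$, with nearest neighbours joined by dual edges; each dual edge crosses exactly one edge of $\mathbb Z^2$. For $x,y\in\mathbb Z^2$ let $\Gamma(x,y)$ be the set of self-avoiding paths of any length $m\ge 0$ on the dual lattice from $x^\star$ to $y^\star$, and set $$D(x,y):=\inf_{\gamma\in\Gamma(x,y)}\ \sum_{i=1}^m w(e_i),$$ where $e_1,\dots,e_m$ are the edges of $\mathbb Z^2$ crossed by the successive steps of $\gamma$. Write $|x|_1=|x_1|+|x_2|$ and $|x|_\infty=\max(|x_1|,|x_2|)$. **Theorem.** If $\mathbb P$ is admissible, then there is a (deterministic) norm $\rho$ on $\mathbb R^2$ such that: 1. for $\mathbb P$-almost every realization of the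 weights, $$\lim_{n\to\infty}\ \max_{\substack{x,y\in\mathbb Z^2\\ |x|_\infty,|y|_\infty\le n}}\frac{|D(x,y)-\rho(x-y)|}{n}=0$$ (and hence the same with $|\cdot|_\infty$ replaced by the Euclidean norm or by $|\cdot|_1$); 2. for $\mathbb P$-almost every realization of the weights, $\displaystyle\lim_{n\to\infty}\frac{D(0,nx)}n=\rho(x)$ for all $x\in\mathbb Z^2$; 3. for all real $a,b$ such that $w(e)\in[a,b]$ for every edge $e$, $\mathbb P$-almost surely, one has $a|x|_1\le\rho(x)\le b|x|_1$ for all $x\in\mathbb R^2$. -/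

import Mathlib

open MeasureTheory Filter Topology

noncomputable section

namespace DualFPP

/-- The vertices of the square lattice `ℤ²`. -/
abbrev Z2 : Type := Fin 2 → ℤ

/-- The nearest-neighbour graph on `ℤ²`: two vertices are adjacent iff their `ℓ¹`-distance is 1. -/
def lattice : SimpleGraph Z2 where
  Adj x y := ∑ i, |x i - y i| = 1
  symm := ⟨fun x y h => by simpa only [abs_sub_comm] using h⟩
  loopless := ⟨fun x h => by simp at h⟩

/-- The set `𝔹(ℤ²)` of unoriented nearest-neighbour edges. -/
abbrev Edge : Type := lattice.edgeSet

/-- Configurations of strictly positive edge weights, that is, the space `(0,∞)^𝔹(ℤ²)`; it carries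
the product σ-algebra. -/
abbrev Weights : Type := Edge → Set.Ioi (0 : ℝ)

/-- The translate `z + e` of an edge `e`. -/
def Edge.shift (z : Z2) (e : Edge) : Edge :=
  ⟨Sym2.map (fun x => z + x) e.1, by
    obtain ⟨e, he⟩ := e
    induction e using Sym2.ind with
    | _ x y =>
      have h : ∑ i, |x i - y i| = 1 := he
      change ∑ i, |(z + x) i - (z + y) i| = 1
      simpa using h⟩

/-- Lattice translations act on weight configurations by `(z +ᵥ w)(e) = w(z + e)`. -/
instance : VAdd Z2 Weights where
  vadd z w := fun e => w (Edge.shift z e)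

/-- Admissible laws of the weights: stationary and ergodic with respect to the translations of `ℤ²`
(Mathlib's `ErgodicVAdd` includes the invariance of the measure), with the law of every single
weight concentrated on a compact subset of `(0,∞)`. -/
structure Admissible (P : Measure Weights) : Prop where
  ergodic : ErgodicVAdd Z2 Weights P
  compact_support : ∀ e : Edge, ∃ K : Set (Set.Ioi (0 : ℝ)), IsCompact K ∧ ∀ᵐ w ∂P, w e ∈ K

/-- The dual lattice has the vertices `x⋆ = x + (½,½)`, `x ∈ ℤ²`, with nearest neighbours joined.
We record `x⋆` by `x`, so that dual paths are paths of `lattice`. The dual edge `(x⋆, y⋆)`, for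
adjacent `x` and `y`, separates the two unit squares with lower left corners `x` and `y`; it is dual
to the edge shared by these squares, whose endpoints are the coordinatewise maximum `x ⊔ y` and
`(x ⊓ y) + (1,1)`. -/
def crossed {x y : Z2} (h : lattice.Adj x y) : Edge :=
  ⟨s(x ⊔ y, x ⊓ y + 1), by
    have h' : ∑ i, |x i - y i| = 1 := h
    change ∑ i, |(x ⊔ y) i - (x ⊓ y + 1) i| = 1
    simp only [Fin.sum_univ_two, Pi.sup_apply, Pi.inf_apply, Pi.add_apply, Pi.one_apply] at h' ⊢
    have e : ∀ a b : ℤ, a ⊔ b - (a ⊓ b + 1) = |a - b| - 1 := fun a b => by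
      rw [← max_sub_min_eq_abs', sub_sub]
    rw [e, e]
    have := abs_nonneg (x 0 - y 0)
    have := abs_nonneg (x 1 - y 1)
    grind⟩

/-- The total weight `𝔡(γ)` of the edges crossed by a dual path `γ`. -/
def pathWeight (w : Weights) {x y : Z2} (γ : lattice.Walk x y) : ℝ :=
  (γ.darts.map fun a => (w (crossed a.adj) : ℝ)).sum

/-- The dual first-passage distance: the infimum of `𝔡(γ)` over all self-avoiding dual paths `γ`
from `x⋆` to `y⋆`. -/
def D (w : Weights) (x y : Z2) : ℝ :=
  ⨅ γ : lattice.Path x y, pathWeight w γ.1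

/-- The inclusion `ℤ² ⊆ ℝ²`. -/
def toR2 (x : Z2) : Fin 2 → ℝ := fun i => (x i : ℝ)

/-- The box of all `x ∈ ℤ²` with `max (|x₁|, |x₂|) ≤ n`. -/
def box (n : ℕ) : Finset Z2 := Finset.Icc (fun _ => -(n : ℤ)) (fun _ => (n : ℤ))

theorem box_nonempty (n : ℕ) : (box n ×ˢ box n).Nonempty := by
  have h : (0 : Z2) ∈ box n := by
    simp [box, Pi.le_def]
  exact ⟨(0, 0), Finset.mk_mem_product h h⟩

/-- The maximum of `|D(x,y) - ρ(x-y)|/n` over all `x` and `y` in the box of radius `n`. -/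
def maxError (w : Weights) (ρ : (Fin 2 → ℝ) → ℝ) (n : ℕ) : ℝ :=
  (box n ×ˢ box n).sup' (box_nonempty n) fun p => |D w p.1 p.2 - ρ (toR2 (p.1 - p.2))| / n

/-- A seminorm that vanishes only at the origin is a norm. -/
def IsNorm (ρ : Seminorm ℝ (Fin 2 → ℝ)) : Prop := ∀ x, ρ x = 0 → x = 0

end DualFPP

end

open DualFPP

/-! `D` is a random metric, almost surely comparable to the ℓ¹-distance and equivariant under
translations of the weights. Its mean `meanD` is subadditive and symmetric on ℤ², so Fekete's lemma
along integer parts of `n x` yields the seminorm `ρ` (`exists_seminorm_tendsto`); the edge bounds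
pass to `ρ` and make it a norm.

For a fixed `z`, translation by `z` alone need not be ergodic, so a subadditive ergodic theorem
along it could leave a random limit. But translating the weights changes `D w 0 y` by an amount
bounded in `y`, so events about asymptotic rates are invariant under the whole lattice and have
probability 0 or 1 (`rate_dichotomy`). A greedy block decomposition of orbits
(`rate_le_of_subadditive`) rules out rates below the mean rate; the maximal ergodic inequality,
which follows from it, rules out rates above.

The Lipschitz bound upgrades directional convergence to uniformity over boxes around the origin. The
starting point is freed by the maximal inequality again: orbit points with large error are too
sparse to fill a segment of length proportional to `n`, so every orbit point has a good one close by
(`ae_eventually_forall_iterate_le`). Applied along both coordinate axes, this reaches every starting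
point in the box. -/

namespace DualFPP

/-! ### Deterministic properties of the dual first-passage distance -/

/-- The `ℓ¹`-norm of a lattice vector. -/
noncomputable def l1 (x : Z2) : ℝ := ∑ i, |(x i : ℝ)|

theorem l1_nonneg (x : Z2) : 0 ≤ l1 x := Finset.sum_nonneg fun _ _ => abs_nonneg _

theorem l1_add (x y : Z2) : l1 (x + y) ≤ l1 x + l1 y := by
  unfold l1
  rw [← Finset.sum_add_distrib]
  refine Finset.sum_le_sum fun i _ => ?_
  simpa using abs_add_le (x i : ℝ) (y i)

theorem l1_neg (x : Z2) : l1 (-x) = l1 x := by simp [l1]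

theorem l1_sub_comm (x y : Z2) : l1 (x - y) = l1 (y - x) := by rw [← l1_neg, neg_sub]

theorem l1_zero : l1 0 = 0 := by simp [l1]

theorem l1_sub_of_adj {x y : Z2} (h : lattice.Adj x y) : l1 (x - y) = 1 := by
  have h' : ∑ i, |x i - y i| = 1 := h
  have : ((∑ i, |x i - y i| : ℤ) : ℝ) = 1 := by rw [h']; simp
  simpa [l1] using this

theorem shift_crossed (z : Z2) {x y : Z2} (h : lattice.Adj x y)
    (h' : lattice.Adj (z + x) (z + y)) : Edge.shift z (crossed h) = crossed h' := by
  apply Subtype.ext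
  change Sym2.map _ s(x ⊔ y, x ⊓ y + 1) = s((z + x) ⊔ (z + y), (z + x) ⊓ (z + y) + 1)
  rw [Sym2.map_mk, ← add_sup, ← add_inf, add_assoc]

theorem crossed_symm {x y : Z2} (h : lattice.Adj x y) : crossed h.symm = crossed h := by
  apply Subtype.ext
  change s(y ⊔ x, y ⊓ x + 1) = s(x ⊔ y, x ⊓ y + 1)
  rw [sup_comm, inf_comm]

@[simp]
theorem pathWeight_nil (w : Weights) (x : Z2) :
    pathWeight w (SimpleGraph.Walk.nil : lattice.Walk x x) = 0 := by
  simp [pathWeight]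

@[simp]
theorem pathWeight_cons (w : Weights) {x y z : Z2} (h : lattice.Adj x y) (p : lattice.Walk y z) :
    pathWeight w (.cons h p) = w (crossed h) + pathWeight w p := by
  simp [pathWeight]

theorem pathWeight_append (w : Weights) {x y z : Z2} (p : lattice.Walk x y)
    (q : lattice.Walk y z) : pathWeight w (p.append q) = pathWeight w p + pathWeight w q := by
  simp [pathWeight]

theorem pathWeight_reverse (w : Weights) {x y : Z2} (p : lattice.Walk x y) :
    pathWeight w p.reverse = pathWeight w p := by
  induction p with
  | nil => simp
  | cons h p ih =>
    rw [SimpleGraph.Walk.reverse_cons, pathWeight_append, ih, pathWeight_cons, pathWeight_cons,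
      pathWeight_nil, crossed_symm h]
    ring

theorem pathWeight_nonneg (w : Weights) {x y : Z2} (p : lattice.Walk x y) :
    0 ≤ pathWeight w p := by
  refine List.sum_nonneg fun a ha => ?_
  obtain ⟨d, -, rfl⟩ := List.mem_map.1 ha
  exact (w _).2.le

/-- Erasing loops only drops positive weights. Hence every walk bounds `D` from above, and
concatenations need no care about self-avoidance. -/
theorem pathWeight_bypass_le (w : Weights) {x y : Z2} (p : lattice.Walk x y) :
    pathWeight w p.bypass ≤ pathWeight w p := by
  refine (p.darts_bypass_sublist_darts.map _).sum_le_sum fun a ha => ?_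
  obtain ⟨d, -, rfl⟩ := List.mem_map.1 ha
  exact (w _).2.le

theorem le_pathWeight {w : Weights} {a : ℝ} (ha : 0 ≤ a) (hw : ∀ e, a ≤ w e) {x y : Z2}
    (p : lattice.Walk x y) : a * l1 (x - y) ≤ pathWeight w p := by
  induction p with
  | nil => simp [l1_zero]
  | @cons x y z h p ih =>
    rw [pathWeight_cons]
    have h1 : l1 (x - z) ≤ 1 + l1 (y - z) := by
      rw [← l1_sub_of_adj h, ← sub_add_sub_cancel x y z]
      exact l1_add _ _
    nlinarith [hw (crossed h)]

/-- The walk moves one coordinate at a time towards the target, so its length is the ℓ¹-distance. -/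
theorem exists_walk_pathWeight_le (x y : Z2) :
    ∃ p : lattice.Walk x y, ∀ (w : Weights) (b : ℝ), (∀ e, (w e : ℝ) ≤ b) →
      pathWeight w p ≤ b * l1 (x - y) := by
  obtain ⟨n, hn⟩ : ∃ n : ℕ, ∑ i, |x i - y i| = n :=
    Int.eq_ofNat_of_zero_le (Finset.sum_nonneg fun _ _ => abs_nonneg _)
  induction n generalizing x with
  | zero =>
    have : x = y := by
      rw [Fin.sum_univ_two] at hn
      have h0 := abs_nonneg (x 0 - y 0)
      have h1 := abs_nonneg (x 1 - y 1)
      ext i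
      fin_cases i
      · exact sub_eq_zero.1 (abs_eq_zero.1 (by simp only [Fin.zero_eta]; grind))
      · exact sub_eq_zero.1 (abs_eq_zero.1 (by simp only [Fin.mk_one]; grind))
    subst this
    exact ⟨.nil, by simp [l1_zero]⟩
  | succ n ih =>
    obtain ⟨z, hz, hzy⟩ : ∃ z : Z2, lattice.Adj x z ∧ ∑ i, |z i - y i| = n := by
      change ∃ z : Z2, ∑ i, |x i - z i| = 1 ∧ _
      simp only [Fin.sum_univ_two] at hn ⊢
      rcases lt_trichotomy (x 0) (y 0) with h | h | h
      · exact ⟨![x 0 + 1, x 1], by simp, by simp; grind⟩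
      · rcases lt_trichotomy (x 1) (y 1) with h1 | h1 | h1
        · exact ⟨![x 0, x 1 + 1], by simp, by simp; grind⟩
        · simp [h, h1] at hn; omega
        · exact ⟨![x 0, x 1 - 1], by simp, by simp; grind⟩
      · exact ⟨![x 0 - 1, x 1], by simp, by simp; grind⟩
    obtain ⟨p, hp⟩ := ih z hzy
    refine ⟨.cons hz p, fun w b hw => ?_⟩
    have e1 : l1 (x - y) = n + 1 := by
      have := congrArg (Int.cast : ℤ → ℝ) hn
      push_cast at this
      simpa [l1] using this
    have e2 : l1 (z - y) = n := by
      have := congrArg (Int.cast : ℤ → ℝ) hzy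
      push_cast at this
      simpa [l1] using this
    have := hp w b hw
    rw [pathWeight_cons, e1]
    rw [e2] at this
    linarith [hw (crossed hz)]

instance (x y : Z2) : Nonempty (lattice.Path x y) :=
  (exists_walk_pathWeight_le x y).elim fun p _ => ⟨⟨p.bypass, p.bypass_isPath⟩⟩

/-- Countability makes the infimum defining `D` measurable. -/
instance (x y : Z2) : Countable (lattice.Path x y) :=
  Function.Injective.countable (f := fun p : lattice.Path x y => p.1.support)
    fun _ _ h => Subtype.ext (SimpleGraph.Walk.ext_support h)

theorem bddBelow_pathWeight (w : Weights) (x y : Z2) :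
    BddBelow (Set.range fun γ : lattice.Path x y => pathWeight w γ.1) :=
  ⟨0, by rintro _ ⟨γ, rfl⟩; exact pathWeight_nonneg _ _⟩

theorem D_le_pathWeight (w : Weights) {x y : Z2} (p : lattice.Walk x y) :
    D w x y ≤ pathWeight w p :=
  (ciInf_le (bddBelow_pathWeight w x y) ⟨p.bypass, p.bypass_isPath⟩).trans
    (pathWeight_bypass_le w p)

theorem D_nonneg (w : Weights) (x y : Z2) : 0 ≤ D w x y :=
  le_ciInf fun γ => pathWeight_nonneg w γ.1

theorem D_self (w : Weights) (x : Z2) : D w x x = 0 :=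
  le_antisymm (by simpa using D_le_pathWeight w (.nil : lattice.Walk x x)) (D_nonneg w x x)

theorem D_comm (w : Weights) (x y : Z2) : D w x y = D w y x := by
  have key : ∀ x y, D w x y ≤ D w y x := fun x y => le_ciInf fun γ => by
    rw [← pathWeight_reverse]
    exact D_le_pathWeight w _
  exact le_antisymm (key x y) (key y x)

theorem D_triangle (w : Weights) (x y z : Z2) : D w x z ≤ D w x y + D w y z := by
  rw [← sub_le_iff_le_add']
  refine le_ciInf fun q => ?_
  rw [sub_le_iff_le_add', ← sub_le_iff_le_add]
  refine le_ciInf fun p => ?_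
  rw [sub_le_iff_le_add, ← pathWeight_append]
  exact D_le_pathWeight w _

theorem le_D {w : Weights} {a : ℝ} (hw : ∀ e, a ≤ w e) (x y : Z2) : a * l1 (x - y) ≤ D w x y := by
  -- `a` may be negative, since the bounds in the theorem are arbitrary reals.
  rcases le_total 0 a with ha | ha
  · exact le_ciInf fun γ => le_pathWeight ha hw γ.1
  · exact (mul_nonpos_of_nonpos_of_nonneg ha (l1_nonneg _)).trans (D_nonneg w x y)

theorem D_le {w : Weights} {b : ℝ} (hw : ∀ e, (w e : ℝ) ≤ b) (x y : Z2) :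
    D w x y ≤ b * l1 (x - y) := by
  obtain ⟨p, hp⟩ := exists_walk_pathWeight_le x y
  exact (D_le_pathWeight w p).trans (hp w b hw)

theorem vadd_apply (z : Z2) (w : Weights) (e : Edge) : (z +ᵥ w) e = w (Edge.shift z e) := rfl

theorem lattice_adj_add (z : Z2) {x y : Z2} (h : lattice.Adj x y) :
    lattice.Adj (z + x) (z + y) := by
  change ∑ i, |(z + x) i - (z + y) i| = 1
  simpa using (show ∑ i, |x i - y i| = 1 from h)

theorem exists_walk_vadd (z : Z2) {x y : Z2} (p : lattice.Walk x y) :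
    ∃ q : lattice.Walk (z + x) (z + y), ∀ w, pathWeight w q = pathWeight (z +ᵥ w) p := by
  induction p with
  | nil => exact ⟨.nil, by simp⟩
  | cons h p ih =>
    obtain ⟨q, hq⟩ := ih
    refine ⟨.cons (lattice_adj_add z h) q, fun w => ?_⟩
    rw [pathWeight_cons, pathWeight_cons, hq, vadd_apply, shift_crossed z h]

theorem vadd_vadd' (y z : Z2) (w : Weights) : y +ᵥ (z +ᵥ w) = (z + y) +ᵥ w := by
  funext e
  simp only [vadd_apply]
  congr 1
  apply Subtype.ext
  simp [Edge.shift, Sym2.map_map, add_assoc]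

theorem zero_vadd' (w : Weights) : (0 : Z2) +ᵥ w = w := by
  funext e
  rw [vadd_apply]
  congr 1
  apply Subtype.ext
  simp [Edge.shift]

theorem D_vadd (w : Weights) (z x y : Z2) : D (z +ᵥ w) x y = D w (z + x) (z + y) := by
  have key : ∀ (w : Weights) (z x y : Z2), D w (z + x) (z + y) ≤ D (z +ᵥ w) x y :=
    fun w z x y => le_ciInf fun γ => by
      obtain ⟨q, hq⟩ := exists_walk_vadd z γ.1
      rw [← hq]
      exact D_le_pathWeight w q
  refine le_antisymm ?_ (key w z x y)
  have := key (z +ᵥ w) (-z) (z + x) (z + y)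
  rwa [vadd_vadd', add_neg_cancel, zero_vadd', neg_add_cancel_left, neg_add_cancel_left] at this

theorem iterate_vadd (z : Z2) (n : ℕ) (w : Weights) :
    (fun w : Weights => z +ᵥ w)^[n] w = (n • z) +ᵥ w := by
  induction n with
  | zero => simp [zero_vadd']
  | succ n ih => rw [Function.iterate_succ_apply', ih, vadd_vadd', succ_nsmul]

theorem D_sub_D_le {w : Weights} {b : ℝ} (hw : ∀ e, (w e : ℝ) ≤ b) (x y x' y' : Z2) :
    D w x y - D w x' y' ≤ b * l1 (x - x') + b * l1 (y - y') := by
  have h1 := D_triangle w x x' y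
  have h2 := D_triangle w x' y' y
  have h3 := D_le hw x x'
  have h4 := D_le hw y' y
  rw [l1_sub_comm] at h4
  linarith

theorem measurable_pathWeight {x y : Z2} (p : lattice.Walk x y) :
    Measurable fun w => pathWeight w p := by
  induction p with
  | nil => simp
  | cons h p ih =>
    simp only [pathWeight_cons]
    exact (measurable_subtype_coe.comp (measurable_pi_apply _)).add ih

theorem measurable_D (x y : Z2) : Measurable fun w => D w x y :=
  Measurable.iInf fun γ => measurable_pathWeight γ.1

theorem measurable_vadd (z : Z2) : Measurable fun w : Weights => z +ᵥ w :=
  measurable_pi_lambda _ fun e => measurable_pi_apply (Edge.shift z e)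

/-! ### Subadditive processes over a measure-preserving map -/

section Dynamics

variable {Ω : Type*} [MeasurableSpace Ω] {μ : Measure Ω}

theorem ae_forall_iterate {T : Ω → Ω} (hT : MeasurePreserving T μ μ) {p : Ω → Prop}
    (hp : ∀ᵐ ω ∂μ, p ω) : ∀ᵐ ω ∂μ, ∀ j : ℕ, p (T^[j] ω) :=
  ae_all_iff.2 fun j => (hT.iterate j).quasiMeasurePreserving.ae hp

omit [MeasurableSpace Ω] in
theorem le_mul_of_subadditive {T : Ω → Ω} {a : ℕ → Ω → ℝ} {K : ℝ} {ω : Ω}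
    (hsub : ∀ m n ω, a (m + n) ω ≤ a m ω + a n (T^[m] ω)) (ha0 : ∀ ω, a 0 ω ≤ 0)
    (hK : ∀ j, a 1 (T^[j] ω) ≤ K) (n i : ℕ) : a n (T^[i] ω) ≤ n * K := by
  induction n with
  | zero => simpa using ha0 _
  | succ n ih =>
    have h1 := hsub n 1 (T^[i] ω)
    rw [← Function.iterate_add_apply] at h1
    push_cast
    linarith [hK (n + i)]

omit [MeasurableSpace Ω] in
/-- If every orbit point either starts a block of length at most `M` along which `a` grows at rate
at most `η`, or is charged `K`, then `a N` is at most the total charge plus a boundary term. -/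
theorem subadditive_le_birkhoffSum {T : Ω → Ω} {a : ℕ → Ω → ℝ} {φ : Ω → ℝ} {K η : ℝ} {M : ℕ}
    {ω : Ω} (hsub : ∀ m n ω, a (m + n) ω ≤ a m ω + a n (T^[m] ω)) (ha0 : ∀ ω, a 0 ω ≤ 0)
    (hK : ∀ j, a 1 (T^[j] ω) ≤ K) (hK0 : 0 ≤ K) (hη : 0 ≤ η) (hφ : ∀ ω, η ≤ φ ω)
    (h : ∀ ω, (∃ n, 1 ≤ n ∧ n ≤ M ∧ a n ω ≤ n * η) ∨ φ ω = K) (N i : ℕ) :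
    a N (T^[i] ω) ≤ birkhoffSum T φ N (T^[i] ω) + (M + 1) * K := by
  induction N using Nat.strong_induction_on generalizing i with
  | _ N ih =>
  have hpos : ∀ n ω, n * η ≤ birkhoffSum T φ n ω := fun n ω => by
    rw [birkhoffSum]
    simpa using Finset.card_nsmul_le_sum (Finset.range n) (fun k => φ (T^[k] ω)) η
      fun k _ => hφ _
  have step : ∀ n, 1 ≤ n → n ≤ N → a n (T^[i] ω) ≤ birkhoffSum T φ n (T^[i] ω) →
      a N (T^[i] ω) ≤ birkhoffSum T φ N (T^[i] ω) + (M + 1) * K := fun n h1 hN hn => by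
    obtain ⟨k, rfl⟩ := Nat.exists_eq_add_of_le hN
    have e1 := hsub n k (T^[i] ω)
    have e2 := ih k (by omega) (n + i)
    rw [birkhoffSum_add]
    rw [Function.iterate_add_apply] at e2
    linarith
  -- A remainder of length at most `M + 1` is paid for by the boundary term; beyond that, a block of
  -- length at most `M` always fits.
  rcases le_or_gt N (M + 1) with hN | hN
  · have h1 := le_mul_of_subadditive hsub ha0 hK N i
    have h2 : (N : ℝ) ≤ M + 1 := by exact_mod_cast hN
    have h3 : 0 ≤ N * η := by positivity
    nlinarith [hpos N (T^[i] ω)]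
  · rcases h (T^[i] ω) with ⟨n, h1, hM, hn⟩ | hb
    · exact step n h1 (by omega) (hn.trans (hpos _ _))
    · refine step 1 le_rfl (by omega) ?_
      rw [birkhoffSum_one, hb]
      exact hK i

theorem measureReal_eq_one_of_ae [IsProbabilityMeasure μ] {p : Ω → Prop} (h : ∀ᵐ ω ∂μ, p ω) :
    μ.real {ω | p ω} = 1 := by
  rw [measureReal_congr (t := Set.univ) (eventuallyEq_univ.2 h), probReal_univ]

theorem integrable_of_nonneg_of_le [IsFiniteMeasure μ] {f : Ω → ℝ} {K : ℝ} (hf : Measurable f)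
    (h0 : ∀ᵐ ω ∂μ, 0 ≤ f ω) (hK : ∀ᵐ ω ∂μ, f ω ≤ K) : Integrable f μ := by
  refine Integrable.of_bound hf.aestronglyMeasurable K ?_
  filter_upwards [h0, hK] with ω h1 h2
  rwa [Real.norm_of_nonneg h1]

theorem integral_birkhoffSum {T : Ω → Ω} (hT : MeasurePreserving T μ μ) {f : Ω → ℝ}
    (hf : Integrable f μ) (n : ℕ) :
    Integrable (birkhoffSum T f n) μ ∧ ∫ ω, birkhoffSum T f n ω ∂μ = n * ∫ ω, f ω ∂μ := by
  have hi : ∀ j, Integrable (fun ω => f (T^[j] ω)) μ := fun j =>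
    (hT.iterate j).integrable_comp_of_integrable hf
  refine ⟨integrable_finsetSum _ fun j _ => hi j, ?_⟩
  simp only [birkhoffSum]
  rw [integral_finsetSum _ fun j _ => hi j]
  have : ∀ j, ∫ ω, f (T^[j] ω) ∂μ = ∫ ω, f ω ∂μ := fun j => by
    conv_rhs => rw [← (hT.iterate j).map_eq]
    rw [integral_map (hT.iterate j).measurable.aemeasurable]
    rw [(hT.iterate j).map_eq]
    exact hf.aestronglyMeasurable
  simp [this]

/-- For a subadditive process with mean growth rate at least `r`, the probability of ever seeing
a growth rate at most `η` is controlled. -/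
theorem rate_le_of_subadditive [IsProbabilityMeasure μ] {T : Ω → Ω} (hT : MeasurePreserving T μ μ)
    {a : ℕ → Ω → ℝ} (ham : ∀ n, Measurable (a n))
    (hsub : ∀ m n ω, a (m + n) ω ≤ a m ω + a n (T^[m] ω)) (ha0 : ∀ ω, a 0 ω ≤ 0)
    (hpos : ∀ᵐ ω ∂μ, ∀ n, 0 ≤ a n ω) {K η r : ℝ} (hK : ∀ᵐ ω ∂μ, a 1 ω ≤ K) (hη : 0 ≤ η)
    (hηK : η ≤ K) (hr : ∀ N : ℕ, N * r ≤ ∫ ω, a N ω ∂μ) :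
    r ≤ K - (K - η) * μ.real {ω | ∃ n : ℕ, 1 ≤ n ∧ a n ω ≤ n * η} := by
  set E : ℕ → Set Ω := fun M => {ω | ∃ n : ℕ, 1 ≤ n ∧ n ≤ M ∧ a n ω ≤ n * η} with hE
  have hEm : ∀ M, MeasurableSet (E M) := fun M => by
    have : E M = ⋃ n : ℕ, ⋃ _ : 1 ≤ n ∧ n ≤ M, {ω | a n ω ≤ n * η} := by
      ext ω; simp [hE, and_assoc]
    rw [this]
    exact .iUnion fun n => .iUnion fun _ => measurableSet_le (ham n) measurable_const
  have hmono : Monotone E := fun M M' h ω ⟨n, h1, h2, h3⟩ => ⟨n, h1, h2.trans h, h3⟩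
  have hU : {ω | ∃ n : ℕ, 1 ≤ n ∧ a n ω ≤ n * η} = ⋃ M, E M := by
    ext ω
    simp only [hE, Set.mem_ofPred_eq, Set.mem_iUnion]
    exact ⟨fun ⟨n, h1, h2⟩ => ⟨n, n, h1, le_rfl, h2⟩, fun ⟨_, n, h1, _, h2⟩ => ⟨n, h1, h2⟩⟩
  have hlim : Tendsto (fun M => μ.real (E M)) atTop (𝓝 (μ.real (⋃ M, E M))) :=
    (ENNReal.tendsto_toReal (measure_ne_top μ _)).comp (tendsto_measure_iUnion_atTop hmono)
  rw [hU]
  -- Cap the block length at `M`; the capped events increase to the full one. The charge `φ` is `η`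
  -- where such a block starts and `K` elsewhere.
  refine ge_of_tendsto' ((hlim.const_mul (K - η)).const_sub K) fun M => ?_
  set φ : Ω → ℝ := fun ω => K - (K - η) * (E M).indicator 1 ω with hφ
  have hind : Integrable ((E M).indicator (1 : Ω → ℝ)) μ :=
    (integrable_const (1 : ℝ)).indicator (hEm M)
  have hφi : Integrable φ μ := (integrable_const K).sub (hind.const_mul _)
  have hφint : ∫ ω, φ ω ∂μ = K - (K - η) * μ.real (E M) := by
    rw [hφ, integral_sub (integrable_const K) (hind.const_mul _), integral_const_mul,
      integral_indicator_one (hEm M)]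
    simp
  have hdich : ∀ ω, (ω ∈ E M ∧ φ ω = η) ∨ (ω ∉ E M ∧ φ ω = K) := fun ω => by
    by_cases h : ω ∈ E M <;> simp [hφ, h]
  have hbound : ∀ N : ℕ, N * r ≤ N * (∫ ω, φ ω ∂μ) + (M + 1) * K := fun N => by
    obtain ⟨h1, h2⟩ := integral_birkhoffSum hT hφi N
    refine (hr N).trans ?_
    have hle : ∀ᵐ ω ∂μ, a N ω ≤ birkhoffSum T φ N ω + (M + 1) * K := by
      filter_upwards [ae_forall_iterate hT hK] with ω hω
      refine subadditive_le_birkhoffSum hsub ha0 hω (hη.trans hηK) hη ?_ ?_ N 0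
      · intro ω
        rcases hdich ω with h | h <;> linarith
      · intro ω
        rcases hdich ω with h | h
        · exact Or.inl h.1
        · exact Or.inr h.2
    have hN0 : ∀ᵐ ω ∂μ, 0 ≤ a N ω := hpos.mono fun ω h => h N
    have hNK : ∀ᵐ ω ∂μ, a N ω ≤ N * K := by
      filter_upwards [ae_forall_iterate hT hK] with ω hω
      exact le_mul_of_subadditive hsub ha0 hω N 0
    have := integral_mono_ae (integrable_of_nonneg_of_le (ham N) hN0 hNK)
      (h1.add (integrable_const ((M + 1) * K))) hle
    refine this.trans (le_of_eq ?_)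
    simp only [Pi.add_apply]
    rw [integral_add h1 (integrable_const _), h2]
    simp
  rw [← hφint]
  -- The boundary term does not depend on `N`, so it is negligible for large `N`.
  by_contra! hlt
  obtain ⟨N, hN⟩ := exists_nat_gt ((M + 1) * K / (r - ∫ ω, φ ω ∂μ))
  rw [div_lt_iff₀ (sub_pos.2 hlt)] at hN
  linarith [hbound N]

/-- Maximal ergodic inequality for bounded nonnegative functions. -/
theorem mul_measure_birkhoffSum_ge_le [IsProbabilityMeasure μ] {T : Ω → Ω}
    (hT : MeasurePreserving T μ μ) {f : Ω → ℝ} (hfm : Measurable f) (hf0 : ∀ ω, 0 ≤ f ω) {K : ℝ}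
    (hfK : ∀ᵐ ω ∂μ, f ω ≤ K) (η : ℝ) :
    η * μ.real {ω | ∃ n : ℕ, 1 ≤ n ∧ n * η ≤ birkhoffSum T f n ω} ≤ ∫ ω, f ω ∂μ := by
  rcases le_total η 0 with h0 | h0
  · exact (mul_nonpos_of_nonpos_of_nonneg h0 measureReal_nonneg).trans (integral_nonneg hf0)
  -- Enlarging `K` is harmless and makes the rate `K - η` nonnegative.
  wlog hK : η ≤ K generalizing K
  · exact this (K := max K η) (hfK.mono fun ω h => h.trans (le_max_left _ _)) (le_max_right _ _)
  have hfi : Integrable f μ := integrable_of_nonneg_of_le hfm (ae_of_all _ hf0) hfK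
  have hgi : Integrable (fun ω => K - f ω) μ := (integrable_const K).sub hfi
  have hsum : ∀ n ω, birkhoffSum T (fun ω => K - f ω) n ω = n * K - birkhoffSum T f n ω :=
    fun n ω => by simp [birkhoffSum, Finset.sum_sub_distrib]
  -- Low averages of the reflected function `K - f` are high averages of `f`, and its Birkhoff sums
  -- are additive.
  have key := rate_le_of_subadditive hT (a := birkhoffSum T (fun ω => K - f ω)) (K := K)
    (η := K - η) (r := ∫ ω, (K - f ω) ∂μ)
    (fun n => Finset.measurable_fun_sum _ fun j _ =>
      (measurable_const.sub hfm).comp (hT.measurable.iterate j))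
    (fun m n ω => (birkhoffSum_add _ _ m n ω).le) (fun ω => by simp)
    (by
      filter_upwards [ae_forall_iterate hT hfK] with ω hω n
      exact Finset.sum_nonneg fun j _ => sub_nonneg.2 (hω j))
    (ae_of_all _ fun ω => by simpa using hf0 ω) (sub_nonneg.2 hK) (by linarith)
    (fun N => (integral_birkhoffSum hT hgi N).2.ge)
  rw [integral_sub (integrable_const K) hfi] at key
  have hset : {ω | ∃ n : ℕ, 1 ≤ n ∧ birkhoffSum T (fun ω => K - f ω) n ω ≤ n * (K - η)} =
      {ω | ∃ n : ℕ, 1 ≤ n ∧ n * η ≤ birkhoffSum T f n ω} := by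
    ext ω
    refine exists_congr fun n => and_congr_right fun _ => ?_
    rw [hsum]
    constructor <;> intro h <;> linarith
  rw [hset] at key
  simp at key
  linarith

/-- An almost sure upper growth rate of a subadditive process is at most its mean over any block
length. -/
theorem le_integral_of_frequently [IsProbabilityMeasure μ] {T : Ω → Ω}
    (hT : MeasurePreserving T μ μ) {a : ℕ → Ω → ℝ} (ham : ∀ n, Measurable (a n))
    (hsub : ∀ m n ω, a (m + n) ω ≤ a m ω + a n (T^[m] ω)) (ha0 : ∀ ω, a 0 ω ≤ 0)
    (hpos : ∀ n ω, 0 ≤ a n ω) {K : ℝ} (hK : ∀ᵐ ω ∂μ, a 1 ω ≤ K) {η η' : ℝ} (hη : η < η')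
    (h : ∀ᵐ ω ∂μ, ∃ᶠ n : ℕ in atTop, n * η' ≤ a n ω) {k : ℕ} (hk : 1 ≤ k) :
    k * η ≤ ∫ ω, a k ω ∂μ := by
  rcases le_or_gt η 0 with h0 | h0
  · exact (mul_nonpos_of_nonneg_of_nonpos (by positivity) h0).trans
      (integral_nonneg fun ω => hpos k ω)
  have hkK : ∀ᵐ ω ∂μ, a k ω ≤ k * K := by
    filter_upwards [ae_forall_iterate hT hK] with ω hω
    exact le_mul_of_subadditive hsub ha0 hω k 0
  -- Once almost every orbit has a run of `k`-blocks with average at least `k * η`, the maximal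
  -- inequality for `T^[k]` and `a k` concludes.
  have hE : ∀ᵐ ω ∂μ, ∃ n : ℕ, 1 ≤ n ∧ n * (k * η) ≤ birkhoffSum T^[k] (a k) n ω := by
    filter_upwards [h, ae_forall_iterate hT hK] with ω hfr hω
    have hmul : ∀ m, a (m * k) ω ≤ birkhoffSum T^[k] (a k) m ω := fun m => by
      induction m with
      | zero => simpa using ha0 ω
      | succ m ih =>
        have := hsub (m * k) k ω
        rw [birkhoffSum_succ, ← Function.iterate_mul, add_mul, one_mul, mul_comm k m]
        linarith
    have hK0 : 0 ≤ K := (hpos 1 _).trans (hω 0)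
    -- Beyond `n0` the gap `n * (η' - η)` absorbs the cost, at most `k * K`, of the remainder `n %
    -- k`; adding `k` ensures `1 ≤ n / k`.
    obtain ⟨n0, hn0⟩ := exists_nat_gt (k * K / (η' - η))
    obtain ⟨n, hn, hna⟩ := (frequently_atTop.1 hfr) (n0 + k)
    refine ⟨n / k, (Nat.one_le_div_iff (by omega)).2 (by omega), ?_⟩
    have hdm : n / k * k + n % k = n := Nat.div_add_mod' n k
    have h1 := hsub (n / k * k) (n % k) ω
    rw [hdm] at h1
    have h2 := le_mul_of_subadditive hsub ha0 hω (n % k) (n / k * k)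
    have h3 : ((n % k : ℕ) : ℝ) ≤ k := by exact_mod_cast (Nat.mod_lt _ (by omega)).le
    have h4 : (((n / k : ℕ) : ℝ) * k) ≤ n := by exact_mod_cast Nat.div_mul_le_self n k
    have h5 : ((n0 : ℝ) + k) ≤ n := by exact_mod_cast hn
    rw [div_lt_iff₀ (sub_pos.2 hη)] at hn0
    have h6 := hmul (n / k)
    have h7 : (k : ℝ) * K ≤ n * (η' - η) := by
      have : (n0 : ℝ) ≤ n := by linarith [(Nat.cast_nonneg k : (0 : ℝ) ≤ k)]
      nlinarith
    nlinarith
  have := mul_measure_birkhoffSum_ge_le (hT.iterate k) (ham k) (hpos k) hkK (k * η)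
  rwa [measureReal_eq_one_of_ae hE, mul_one] at this

/-- An error that is asymptotically small at almost every point, and varies slowly along orbits,
is asymptotically small uniformly along initial orbit segments. -/
theorem ae_eventually_forall_iterate_le [IsProbabilityMeasure μ] {T : Ω → Ω}
    (hT : MeasurePreserving T μ μ) {F : ℕ → Ω → ℝ} (hFm : ∀ n, Measurable (F n)) {C : ℝ}
    (hC : 0 < C) (hLip : ∀ᵐ ω ∂μ, ∀ n, F n ω ≤ F n (T ω) + C)
    (hF : ∀ᵐ ω ∂μ, ∀ ε > 0, ∀ᶠ n : ℕ in atTop, F n ω ≤ ε * n) :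
    ∀ᵐ ω ∂μ, ∀ ε > 0, ∀ᶠ n : ℕ in atTop, ∀ j ≤ n, F n (T^[j] ω) ≤ ε * n := by
  suffices H : ∀ ε : ℝ, 0 < ε → ∀ᵐ ω ∂μ, ∀ᶠ n : ℕ in atTop, ∀ j ≤ n,
      F n (T^[j] ω) ≤ 2 * ε * n by
    have H' := ae_all_iff.2 fun k : ℕ => H (1 / (k + 1)) (by positivity)
    filter_upwards [H'] with ω hω ε hε
    obtain ⟨k, hk⟩ := exists_nat_one_div_lt (half_pos hε)
    filter_upwards [hω k] with n hn j hj
    refine (hn j hj).trans ?_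
    gcongr
    linarith
  intro ε hε
  -- Moving by at most `δ * n` along the orbit costs at most `ε * n`.
  set δ : ℝ := min 1 (ε / C) with hδ
  have hδ0 : 0 < δ := lt_min one_pos (by positivity)
  have hδ1 : δ ≤ 1 := min_le_left _ _
  have hδC : C * δ ≤ ε := by
    have := min_le_right 1 (ε / C)
    rwa [le_div_iff₀ hC, mul_comm] at this
  set B : ℕ → Set Ω := fun M => {ω | ∃ n, M ≤ n ∧ ε * n < F n ω} with hB
  have hBm : ∀ M, MeasurableSet (B M) := fun M => by
    have : B M = ⋃ n, ⋃ _ : M ≤ n, {ω | ε * n < F n ω} := by ext; simp [hB]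
    rw [this]
    exact .iUnion fun n => .iUnion fun _ => measurableSet_lt measurable_const (hFm n)
  have hanti : Antitone B := fun M M' h ω ⟨n, h1, h2⟩ => ⟨n, h.trans h1, h2⟩
  have hBlim : Tendsto (fun M => μ.real (B M)) atTop (𝓝 0) := by
    have h0 : μ (⋂ M, B M) = 0 := by
      refine measure_mono_null ?_ hF
      intro ω hω hc
      obtain ⟨M, hM⟩ := eventually_atTop.1 (hc ε hε)
      obtain ⟨n, hn, hlt⟩ := Set.mem_iInter.1 hω M
      exact absurd (hM n hn) (not_le.2 hlt)
    have := (ENNReal.tendsto_toReal (measure_ne_top μ _)).comp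
      (tendsto_measure_iInter_atTop (fun M => (hBm M).nullMeasurableSet) hanti
        ⟨0, measure_ne_top μ _⟩)
    rw [h0] at this
    exact this
  -- A bad run of length `q ≥ δ * n` among the first `j + q ≤ 3 * n` orbit points has frequency at
  -- least `δ / 3`.
  set G : ℕ → Set Ω := fun M =>
    {ω | ∃ n : ℕ, 1 ≤ n ∧ n * (δ / 3) ≤ birkhoffSum T ((B M).indicator 1) n ω} with hG
  have hGle : ∀ M, δ / 3 * μ.real (G M) ≤ μ.real (B M) := fun M => by
    rw [← integral_indicator_one (hBm M)]
    refine mul_measure_birkhoffSum_ge_le hT (measurable_one.indicator (hBm M)) (K := 1) ?_ ?_ _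
    · exact fun ω => Set.indicator_nonneg (fun _ _ => zero_le_one) _
    · exact ae_of_all _ fun ω => Set.indicator_le_self' (fun _ _ => zero_le_one) _
  have hGnull : μ (⋂ M, G M) = 0 := by
    rw [← measureReal_eq_zero_iff]
    have h1 : ∀ M, μ.real (⋂ M, G M) ≤ 3 / δ * μ.real (B M) := fun M => by
      have h2 : μ.real (⋂ M, G M) ≤ μ.real (G M) := measureReal_mono (Set.iInter_subset _ _)
      have h3 := hGle M
      rw [div_mul_eq_mul_div, le_div_iff₀ hδ0]
      nlinarith
    refine le_antisymm ?_ measureReal_nonneg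
    have := ge_of_tendsto' (hBlim.const_mul (3 / δ)) h1
    simpa using this
  have hG' : ∀ᵐ ω ∂μ, ω ∉ ⋂ M, G M := measure_eq_zero_iff_ae_notMem.1 hGnull
  filter_upwards [hG', ae_forall_iterate hT hLip] with ω hω hL
  have hL' : ∀ n j i, F n (T^[j] ω) ≤ F n (T^[j + i] ω) + C * i := fun n j i => by
    induction i with
    | zero => simp
    | succ i ih =>
      have := hL (j + i) n
      rw [← Function.iterate_succ_apply' T] at this
      rw [← add_assoc]
      push_cast
      linarith
  obtain ⟨M, hM⟩ : ∃ M, ω ∉ G M := by simpa using hω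
  filter_upwards [eventually_ge_atTop (max M 1)] with n hn j hj
  have hnM : M ≤ n := (le_max_left _ _).trans hn
  have hn1 : (1 : ℝ) ≤ n := by exact_mod_cast (le_max_right _ _).trans hn
  set q := ⌊δ * n⌋₊ + 1 with hq
  have hq1 : δ * n ≤ q := by
    rw [hq]; push_cast; exact (Nat.lt_floor_add_one _).le
  have hq2 : (q : ℝ) ≤ δ * n + 1 := by
    rw [hq]; push_cast; linarith [Nat.floor_le (show 0 ≤ δ * n by positivity)]
  -- Otherwise the whole window after `j` lies in `B M`, which puts `ω` in `G M`.
  obtain ⟨i, hi, hiB⟩ : ∃ i < q, T^[j + i] ω ∉ B M := by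
    by_contra! hall
    refine hM ⟨j + q, by omega, ?_⟩
    rw [birkhoffSum_add]
    have h1 : 0 ≤ birkhoffSum T ((B M).indicator (1 : Ω → ℝ)) j ω :=
      Finset.sum_nonneg fun i _ => Set.indicator_nonneg (fun _ _ => zero_le_one) _
    have h2 : birkhoffSum T ((B M).indicator (1 : Ω → ℝ)) q (T^[j] ω) = q := by
      rw [birkhoffSum, Finset.sum_congr rfl (g := fun _ => (1 : ℝ))]
      · simp
      · intro i hi
        rw [← Function.iterate_add_apply, add_comm i j,
          Set.indicator_of_mem (hall i (Finset.mem_range.1 hi))]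
        rfl
    rw [h2]
    have h3 : (j : ℝ) ≤ n := by exact_mod_cast hj
    have h4 : ((j + q : ℕ) : ℝ) ≤ 3 * n := by push_cast; nlinarith
    nlinarith
  have h1 : F n (T^[j + i] ω) ≤ ε * n := by
    by_contra! hlt
    exact hiB ⟨n, hnM, hlt⟩
  have h2 : (i : ℝ) ≤ δ * n := by
    have : i ≤ ⌊δ * n⌋₊ := by omega
    exact (Nat.le_floor_iff (by positivity)).1 this
  have h3 := hL' n j i
  have h4 : C * i ≤ ε * n := by nlinarith
  linarith

end Dynamics

/-! ### The norm of a subadditive function on `ℤ²` -/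

/-- The coordinatewise integer part of a real vector. -/
noncomputable def floorVec (x : Fin 2 → ℝ) : Z2 := fun i => ⌊x i⌋

/-- The `ℓ¹`-distance of a lattice point to a real vector. -/
noncomputable def l1Dist (v : Z2) (x : Fin 2 → ℝ) : ℝ := ∑ i, |(v i : ℝ) - x i|

theorem l1_sub_le (u v : Z2) (x : Fin 2 → ℝ) : l1 (u - v) ≤ l1Dist u x + l1Dist v x := by
  simp only [l1, l1Dist, ← Finset.sum_add_distrib]
  refine Finset.sum_le_sum fun i _ => ?_
  rw [abs_sub_comm (v i : ℝ) (x i)]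
  simpa using abs_sub_le (u i : ℝ) (x i) (v i)

theorem l1Dist_le (v : Z2) (x y : Fin 2 → ℝ) : l1Dist v y ≤ l1Dist v x + ∑ i, |x i - y i| := by
  simp only [l1Dist, ← Finset.sum_add_distrib]
  exact Finset.sum_le_sum fun i _ => abs_sub_le _ _ _

theorem l1Dist_add (u v : Z2) (x y : Fin 2 → ℝ) :
    l1Dist (u + v) (x + y) ≤ l1Dist u x + l1Dist v y := by
  simp only [l1Dist, ← Finset.sum_add_distrib]
  refine Finset.sum_le_sum fun i _ => ?_
  have := abs_add_le ((u i : ℝ) - x i) (v i - y i)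
  rw [← add_sub_add_comm] at this
  simpa using this

theorem l1Dist_neg (v : Z2) (x : Fin 2 → ℝ) : l1Dist (-v) (-x) = l1Dist v x := by
  refine Finset.sum_congr rfl fun i _ => ?_
  rw [← abs_neg]
  congr 1
  simp
  ring

theorem l1Dist_floorVec (x : Fin 2 → ℝ) : l1Dist (floorVec x) x ≤ 2 := by
  have : ∀ t : ℝ, |(⌊t⌋ : ℝ) - t| ≤ 1 := fun t => by
    rw [abs_le]
    constructor <;> linarith [Int.floor_le t, Int.lt_floor_add_one t]
  simp only [l1Dist, floorVec, Fin.sum_univ_two]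
  linarith [this (x 0), this (x 1)]

theorem abs_l1_sub_le (v : Z2) (x : Fin 2 → ℝ) : |l1 v - (∑ i, |x i|)| ≤ l1Dist v x := by
  simp only [l1, l1Dist, ← Finset.sum_sub_distrib]
  refine (Finset.abs_sum_le_sum_abs _ _).trans (Finset.sum_le_sum fun i _ => ?_)
  exact abs_abs_sub_abs_le_abs_sub _ _

theorem tendsto_div_of_abs_sub_le {u v : ℕ → ℝ} {C l : ℝ} (h : ∀ n, |u n - v n| ≤ C)
    (hu : Tendsto (fun n => u n / n) atTop (𝓝 l)) : Tendsto (fun n => v n / n) atTop (𝓝 l) := by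
  have h0 : Tendsto (fun n : ℕ => (u n - v n) / n) atTop (𝓝 0) := by
    refine squeeze_zero_norm (fun n => ?_) (tendsto_const_div_atTop_nhds_zero_nat C)
    rw [norm_div, Real.norm_eq_abs, Real.norm_natCast]
    gcongr
    exact h n
  have := hu.sub h0
  rw [sub_zero] at this
  refine this.congr fun n => ?_
  rw [← sub_div, sub_sub_cancel]

theorem tendsto_l1_div {v : ℕ → Z2} {x : Fin 2 → ℝ} {C : ℝ}
    (h : ∀ n : ℕ, l1Dist (v n) ((n : ℝ) • x) ≤ C) :
    Tendsto (fun n => l1 (v n) / n) atTop (𝓝 (∑ i, |x i|)) := by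
  refine tendsto_div_of_abs_sub_le (u := fun n : ℕ => n * ∑ i, |x i|) (C := C) (fun n => ?_) ?_
  · rw [abs_sub_comm]
    have := (abs_l1_sub_le (v n) ((n : ℝ) • x)).trans (h n)
    simpa [abs_mul, mul_add] using this
  · refine tendsto_const_nhds.congr' ?_
    filter_upwards [eventually_ge_atTop 1] with n hn
    have : (n : ℝ) ≠ 0 := by positivity
    field_simp

/-- A symmetric subadditive function on `ℤ²` of at most linear growth has a seminorm as its
asymptotic slope. -/
theorem exists_seminorm_tendsto {g : Z2 → ℝ} {β : ℝ} (hadd : ∀ x y, g (x + y) ≤ g x + g y)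
    (hneg : ∀ x, g (-x) = g x) (h0 : ∀ x, 0 ≤ g x) (hβ : ∀ x, g x ≤ β * l1 x) :
    ∃ ρ : Seminorm ℝ (Fin 2 → ℝ), ∀ (x : Fin 2 → ℝ) (v : ℕ → Z2) (C : ℝ),
      (∀ n : ℕ, l1Dist (v n) ((n : ℝ) • x) ≤ C) →
        Tendsto (fun n => g (v n) / n) atTop (𝓝 (ρ x)) := by
  wlog hβ0 : 0 ≤ β generalizing β
  · refine this (β := 0) (fun x => (hβ x).trans ?_) le_rfl
    exact mul_le_mul_of_nonneg_right (not_le.1 hβ0).le (l1_nonneg x)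
  have hle : ∀ x y, g x - g y ≤ β * l1 (x - y) := fun x y => by
    have := hadd (x - y) y
    rw [sub_add_cancel] at this
    linarith [hβ (x - y)]
  have habs : ∀ x y, |g x - g y| ≤ β * l1 (x - y) := fun x y => by
    rw [abs_le]
    have := hle y x
    rw [l1_sub_comm] at this
    exact ⟨by linarith, hle x y⟩
  have hfl : ∀ (x : Fin 2 → ℝ) (n : ℕ), l1Dist (floorVec ((n : ℝ) • x)) ((n : ℝ) • x) ≤ 2 :=
    fun x n => l1Dist_floorVec _
  have hex : ∀ x : Fin 2 → ℝ, ∃ r,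
      Tendsto (fun n : ℕ => g (floorVec ((n : ℝ) • x)) / n) atTop (𝓝 r) := fun x => by
    -- Three roundings, each off by at most 2 in ℓ¹, cost `6 * β`; adding this constant restores
    -- subadditivity.
    have hsub : Subadditive fun n : ℕ => g (floorVec ((n : ℝ) • x)) + 6 * β := fun m n => by
      have h1 := hle (floorVec (((m + n : ℕ) : ℝ) • x))
        (floorVec ((m : ℝ) • x) + floorVec ((n : ℝ) • x))
      have h2 := l1_sub_le (floorVec (((m + n : ℕ) : ℝ) • x))
        (floorVec ((m : ℝ) • x) + floorVec ((n : ℝ) • x)) (((m + n : ℕ) : ℝ) • x)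
      have h3 := l1Dist_add (floorVec ((m : ℝ) • x)) (floorVec ((n : ℝ) • x)) ((m : ℝ) • x)
        ((n : ℝ) • x)
      rw [← add_smul, ← Nat.cast_add] at h3
      have h4 := hadd (floorVec ((m : ℝ) • x)) (floorVec ((n : ℝ) • x))
      have h5 : l1 (floorVec (((m + n : ℕ) : ℝ) • x) -
          (floorVec ((m : ℝ) • x) + floorVec ((n : ℝ) • x))) ≤ 6 := by
        linarith [hfl x (m + n), hfl x m, hfl x n]
      have h6 := mul_le_mul_of_nonneg_left h5 hβ0
      simp only
      linarith
    have hbdd : BddBelow (Set.range fun n : ℕ => (g (floorVec ((n : ℝ) • x)) + 6 * β) / n) :=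
      ⟨0, by
        rintro _ ⟨n, rfl⟩
        have := h0 (floorVec ((n : ℝ) • x))
        positivity⟩
    refine ⟨_, tendsto_div_of_abs_sub_le (C := 6 * β) (fun n => ?_) (hsub.tendsto_lim hbdd)⟩
    rw [add_sub_cancel_left, abs_of_nonneg (by positivity)]
  choose r hr using hex
  -- Freedom in the approximating lattice points gives each seminorm axiom by a convenient choice of
  -- sequence.
  have key : ∀ (x : Fin 2 → ℝ) (v : ℕ → Z2) (C : ℝ),
      (∀ n : ℕ, l1Dist (v n) ((n : ℝ) • x) ≤ C) →
        Tendsto (fun n => g (v n) / n) atTop (𝓝 (r x)) := fun x v C hC =>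
    tendsto_div_of_abs_sub_le (C := β * (2 + C)) (fun n => (habs _ _).trans <|
      mul_le_mul_of_nonneg_left ((l1_sub_le _ _ _).trans (add_le_add (hfl x n) (hC n))) hβ0) (hr x)
  have radd : ∀ x y, r (x + y) ≤ r x + r y := fun x y => by
    refine le_of_tendsto_of_tendsto' (key (x + y)
      (fun n => floorVec ((n : ℝ) • x) + floorVec ((n : ℝ) • y)) (2 + 2) fun n => ?_)
      ((hr x).add (hr y)) fun n => ?_
    · rw [smul_add]
      exact (l1Dist_add _ _ _ _).trans (add_le_add (hfl x n) (hfl y n))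
    · rw [← add_div]
      gcongr
      exact hadd _ _
  have rneg : ∀ x, r (-x) = r x := fun x => by
    refine tendsto_nhds_unique (key (-x) (fun n => -floorVec ((n : ℝ) • x)) 2 fun n => ?_) ?_
    · rw [smul_neg, l1Dist_neg]
      exact hfl x n
    · simpa only [hneg] using hr x
  -- The rounded points `⌊t n⌋ x` stay near `n t x` and also run along the sequence defining `r x`.
  -- For `t = 0` the index does not tend to infinity, hence the separate case.
  have rsmul : ∀ (t : ℝ) (x), 0 ≤ t → r (t • x) = t * r x := fun t x ht => by
    refine tendsto_nhds_unique (key (t • x) (fun n => floorVec ((⌊t * n⌋₊ : ℝ) • x))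
      (2 + ∑ i, |x i|) fun n => ?_) ?_
    · refine (l1Dist_le _ ((⌊t * n⌋₊ : ℝ) • x) _).trans (add_le_add (hfl x _) ?_)
      refine Finset.sum_le_sum fun i _ => ?_
      have h1 : |(⌊t * n⌋₊ : ℝ) - t * n| ≤ 1 := by
        rw [abs_le]
        constructor <;> linarith [Nat.floor_le (show 0 ≤ t * n by positivity),
          Nat.lt_floor_add_one (t * n)]
      have h2 : ((⌊t * n⌋₊ : ℝ) • x) i - ((n : ℝ) • t • x) i = ((⌊t * n⌋₊ : ℝ) - t * n) * x i := by
        simp; ring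
      rw [h2, abs_mul]
      exact mul_le_of_le_one_left (abs_nonneg _) h1
    · rcases ht.eq_or_lt with rfl | htpos
      · have hg0 : g 0 = 0 := le_antisymm (by simpa [l1_zero] using hβ 0) (h0 0)
        have : floorVec 0 = 0 := by ext; simp [floorVec]
        simp [this, hg0]
      have h1 := (hr x).comp
        (tendsto_nat_floor_atTop.comp (tendsto_natCast_atTop_atTop.const_mul_atTop htpos))
      have h2 := (tendsto_nat_floor_mul_div_atTop ht).comp (tendsto_natCast_atTop_atTop (R := ℝ))
      rw [mul_comm]
      refine (h1.mul h2).congr' ?_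
      filter_upwards [(tendsto_nat_floor_atTop.comp
        (tendsto_natCast_atTop_atTop.const_mul_atTop htpos)).eventually_ge_atTop 1] with n hn
      simp only [Function.comp_apply] at hn ⊢
      have : (⌊t * n⌋₊ : ℝ) ≠ 0 := by positivity
      field_simp
  refine ⟨Seminorm.of r radd fun t x => ?_, key⟩
  rcases le_total 0 t with ht | ht
  · rw [rsmul t x ht, Real.norm_of_nonneg ht]
  · rw [← rneg, ← neg_smul, rsmul (-t) x (by linarith), Real.norm_of_nonpos ht]

/-- A Lipschitz function on `ℤ²` that is sublinear in every direction is uniformly sublinear. -/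
theorem eventually_forall_box_abs_le {E : Z2 → ℝ} {C : ℝ} (hC : 0 ≤ C)
    (hE : ∀ x y, |E x - E y| ≤ C * l1 (x - y))
    (h : ∀ z : Z2, Tendsto (fun n : ℕ => E (n • z) / n) atTop (𝓝 0)) {ε : ℝ} (hε : 0 < ε) :
    ∀ᶠ n : ℕ in atTop, ∀ y ∈ box n, |E y| ≤ ε * n := by
  obtain ⟨L, hL⟩ := exists_nat_gt (4 * C / ε)
  have hL0 : 0 < L := by
    have : (0 : ℝ) < L := lt_of_le_of_lt (by positivity) hL
    exact_mod_cast this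
  have hfin : ∀ᶠ m : ℕ in atTop, ∀ z ∈ box (2 * L), |E (m • z)| ≤ ε / 2 * m := by
    rw [eventually_all_finset]
    intro z _
    filter_upwards [(tendsto_order.1 (h z).abs).2 (ε / 2) (by simpa using half_pos hε),
      eventually_ge_atTop 1] with m hm hm1
    have : (0 : ℝ) < m := by positivity
    rw [abs_div, Nat.abs_cast, div_lt_iff₀ this] at hm
    exact hm.le
  filter_upwards [(Nat.tendsto_div_const_atTop hL0.ne').eventually hfin, eventually_ge_atTop L]
    with n hn hnL y hy
  -- Compare `y` with a multiple `m • z` of a coarse direction: only finitely many `z` occur, and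
  -- the rounding costs at most `2 * C * m ≤ ε / 2 * n`.
  set m := n / L with hm
  have hm1 : 1 ≤ m := (Nat.one_le_div_iff hL0).2 hnL
  have hmL : m * L ≤ n := Nat.div_mul_le_self n L
  have hnm : n ≤ 2 * L * m := by
    have := Nat.lt_div_mul_add (a := n) hL0
    rw [← hm] at this
    nlinarith
  have hm0 : (0 : ℤ) < m := by exact_mod_cast hm1
  set z : Z2 := fun i => y i / m with hz
  simp only [box, Finset.mem_Icc, Pi.le_def] at hy
  have hzb : z ∈ box (2 * L) := by
    have h2 : (n : ℤ) ≤ 2 * L * m := by exact_mod_cast hnm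
    simp only [box, Finset.mem_Icc, Pi.le_def, hz]
    push_cast
    constructor <;> intro i
    · rw [Int.le_ediv_iff_mul_le hm0]
      linarith [hy.1 i]
    · refine Int.ediv_le_of_le_mul hm0 ?_
      linarith [hy.2 i]
  have hdist : l1 (y - m • z) ≤ 2 * m := by
    have : ∀ i, |((y - m • z) i : ℝ)| ≤ m := fun i => by
      have h1 := Int.emod_nonneg (y i) hm0.ne'
      have h2 := Int.emod_lt_of_pos (y i) hm0
      have h3 : (y - m • z) i = y i % m := by
        simp [hz, Int.emod_def]
      rw [h3, abs_of_nonneg (by exact_mod_cast h1)]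
      exact_mod_cast h2.le
    simp only [l1, Fin.sum_univ_two]
    linarith [this 0, this 1]
  have h1 := hE y (m • z)
  have h2 := hn z hzb
  have h3 : (m : ℝ) * L ≤ n := by exact_mod_cast hmL
  have h4 : C * l1 (y - m • z) ≤ C * (2 * m) := mul_le_mul_of_nonneg_left hdist hC
  have hL1 : (1 : ℝ) ≤ L := by exact_mod_cast hL0
  rw [div_lt_iff₀ hε] at hL
  have h5 : ε / 2 * m ≤ ε / 2 * n := by
    have : (m : ℝ) ≤ n := by nlinarith [(Nat.cast_nonneg m : (0 : ℝ) ≤ m)]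
    gcongr
  have h6 : C * (2 * m) ≤ ε / 2 * n := by
    nlinarith [(Nat.cast_nonneg m : (0 : ℝ) ≤ m)]
  have h7 := abs_sub_abs_le_abs_sub (E y) (E (m • z))
  linarith

/-! ### Admissible laws -/

theorem exists_pos_bounds_of_isCompact {K : Set (Set.Ioi (0 : ℝ))} (hK : IsCompact K) :
    ∃ a b : ℝ, 0 < a ∧ ∀ t ∈ K, a ≤ (t : ℝ) ∧ (t : ℝ) ≤ b := by
  rcases K.eq_empty_or_nonempty with rfl | hne
  · exact ⟨1, 1, one_pos, by simp⟩
  · obtain ⟨s, -, hs⟩ := hK.exists_isMinOn hne continuous_subtype_val.continuousOn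
    obtain ⟨t, -, ht⟩ := hK.exists_isMaxOn hne continuous_subtype_val.continuousOn
    exact ⟨s, t, s.2, fun u hu => ⟨hs hu, ht hu⟩⟩

theorem measurableSet_frequently {Ω : Type*} [MeasurableSpace Ω] {s : ℕ → Set Ω}
    (h : ∀ n, MeasurableSet (s n)) : MeasurableSet {ω | ∃ᶠ n in atTop, ω ∈ s n} := by
  convert MeasurableSet.measurableSet_limsup h using 1
  ext ω
  exact mem_limsup_iff_frequently_mem.symm

/-- Quantifying over all `k` expresses that the liminf of `u n / n` is at most `η`, which a bounded
change cannot affect; a finer level `m` leaves room for `C`. -/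
theorem forall_frequently_le_of_abs_sub_le {u v : ℕ → ℝ} {C η : ℝ} (huv : ∀ n, |u n - v n| ≤ C)
    (h : ∀ k : ℕ, ∃ᶠ n : ℕ in atTop, u n ≤ n * (η + 1 / (k + 1))) (k : ℕ) :
    ∃ᶠ n : ℕ in atTop, v n ≤ n * (η + 1 / (k + 1)) := by
  have hk : (0 : ℝ) < 1 / (k + 1) := by positivity
  obtain ⟨m, hm⟩ := exists_nat_one_div_lt hk
  obtain ⟨N, hN⟩ := exists_nat_gt (C / (1 / (k + 1) - 1 / (m + 1)))
  rw [div_lt_iff₀ (sub_pos.2 hm)] at hN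
  refine ((h m).and_eventually (eventually_ge_atTop N)).mono fun n hn => ?_
  have h1 : (N : ℝ) ≤ n := by exact_mod_cast hn.2
  have h2 := (abs_le.1 (huv n)).1
  have h3 : C ≤ n * (1 / (k + 1) - 1 / (m + 1)) :=
    hN.le.trans (mul_le_mul_of_nonneg_right h1 (sub_pos.2 hm).le)
  linarith [hn.1]

variable {P : Measure Weights}

theorem Admissible.measurePreserving (hP : Admissible P) (z : Z2) :
    MeasurePreserving (fun w : Weights => z +ᵥ w) P P := by
  have := hP.ergodic
  refine ⟨measurable_vadd z, Measure.ext fun s hs => ?_⟩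
  rw [Measure.map_apply (measurable_vadd z) hs]
  exact VAddInvariantMeasure.measure_preimage_vadd z hs

theorem Admissible.ae_or_ae_not (hP : Admissible P) {p : Weights → Prop}
    (hp : MeasurableSet {w | p w}) (h : ∀ z : Z2, ∀ᵐ w ∂P, p (z +ᵥ w) ↔ p w) :
    (∀ᵐ w ∂P, p w) ∨ ∀ᵐ w ∂P, ¬ p w := by
  have := hP.ergodic
  have := ErgodicVAdd.aeconst_of_forall_preimage_vadd_ae_eq (G := Z2) (μ := P) hp
    fun z => eventuallyEq_set.2 (h z)
  rcases eventuallyConst_set'.1 this with h | h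
  · exact Or.inr (eventuallyEq_empty.1 h)
  · exact Or.inl (eventuallyEq_univ.1 h)

theorem exists_vertex_shift (e : Edge) :
    ∃ (x v : Z2) (h : lattice.Adj 0 v), v ∈ box 1 ∧ e = Edge.shift x ⟨s(0, v), h⟩ := by
  obtain ⟨e, he⟩ := e
  induction e using Sym2.ind with
  | _ x y =>
    have hxy : ∑ i, |x i - y i| = 1 := he
    have h : lattice.Adj 0 (y - x) := by
      have := lattice_adj_add (-x) (show lattice.Adj x y from he)
      rwa [neg_add_cancel, neg_add_eq_sub] at this
    refine ⟨x, y - x, h, ?_, ?_⟩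
    · simp only [box, Finset.mem_Icc, Pi.le_def, Fin.forall_fin_two, Pi.sub_apply]
      simp only [Fin.sum_univ_two] at hxy
      push_cast
      grind
    · apply Subtype.ext
      simp [Edge.shift]

/-- Edges form finitely many translation orbits, so stationarity makes the bounds on single weights
uniform; compactness in `(0,∞)` keeps the lower one positive. -/
theorem Admissible.exists_bounds (hP : Admissible P) :
    ∃ α β : ℝ, 0 < α ∧ ∀ᵐ w ∂P, ∀ e : Edge, α ≤ w e ∧ (w e : ℝ) ≤ β := by
  have h1 : ∀ v : Z2, ∃ a b : ℝ, 0 < a ∧ ∀ h : lattice.Adj 0 v,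
      ∀ᵐ w : Weights ∂P, a ≤ (w ⟨s(0, v), h⟩ : ℝ) ∧ (w ⟨s(0, v), h⟩ : ℝ) ≤ b := fun v => by
    by_cases h : lattice.Adj 0 v
    · obtain ⟨K, hK, hw⟩ := hP.compact_support ⟨s(0, v), h⟩
      obtain ⟨a, b, ha, hab⟩ := exists_pos_bounds_of_isCompact hK
      exact ⟨a, b, ha, fun _ => hw.mono fun w hwK => hab _ hwK⟩
    · exact ⟨1, 1, one_pos, fun h' => absurd h' h⟩
  choose a b ha hab using h1
  have hne : (box 1).Nonempty := ⟨0, by simp [box, Pi.le_def]⟩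
  refine ⟨(box 1).inf' hne a, (box 1).sup' hne b, (Finset.lt_inf'_iff hne).2 fun v _ => ha v, ?_⟩
  refine ae_all_iff.2 fun e => ?_
  obtain ⟨x, v, h, hv, rfl⟩ := exists_vertex_shift e
  filter_upwards [(hP.measurePreserving x).quasiMeasurePreserving.ae (hab v h)] with w hw
  exact ⟨(Finset.inf'_le a hv).trans hw.1, hw.2.trans (Finset.le_sup' b hv)⟩

/-- The mean dual first-passage distance from the origin. -/
noncomputable def meanD (P : Measure Weights) (x : Z2) : ℝ := ∫ w, D w 0 x ∂P

theorem meanD_nonneg (x : Z2) : 0 ≤ meanD P x := integral_nonneg fun w => D_nonneg w 0 x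

theorem Admissible.integral_D (hP : Admissible P) (x y : Z2) :
    ∫ w, D w x (x + y) ∂P = meanD P y := by
  rw [meanD]
  conv_rhs => rw [← (hP.measurePreserving x).map_eq]
  rw [integral_map (measurable_vadd x).aemeasurable (measurable_D 0 y).aestronglyMeasurable]
  simp only [D_vadd, add_zero]

theorem Admissible.meanD_neg (hP : Admissible P) (x : Z2) : meanD P (-x) = meanD P x := by
  rw [← hP.integral_D (-x) x, neg_add_cancel, meanD]
  simp only [D_comm]

section Bounded

variable [IsProbabilityMeasure P] {β : ℝ}

theorem integrable_D (hβ : ∀ᵐ w ∂P, ∀ e : Edge, (w e : ℝ) ≤ β) (x y : Z2) :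
    Integrable (fun w => D w x y) P :=
  integrable_of_nonneg_of_le (measurable_D x y) (ae_of_all _ fun w => D_nonneg w x y)
    (hβ.mono fun _ hw => D_le hw x y)

theorem Admissible.meanD_add_le (hP : Admissible P) (hβ : ∀ᵐ w ∂P, ∀ e : Edge, (w e : ℝ) ≤ β)
    (x y : Z2) : meanD P (x + y) ≤ meanD P x + meanD P y := by
  rw [← hP.integral_D x y, meanD, meanD,
    ← integral_add (integrable_D hβ _ _) (integrable_D hβ _ _)]
  exact integral_mono (integrable_D hβ _ _) ((integrable_D hβ _ _).add (integrable_D hβ _ _))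
    fun w => D_triangle w _ _ _

end Bounded

variable [IsProbabilityMeasure P] {β : ℝ}

/-! ### Convergence in a fixed direction -/

theorem abs_D_vadd_sub_le {w : Weights} (hw : ∀ e, (w e : ℝ) ≤ β) (z x y : Z2) :
    |D (z +ᵥ w) x y - D w x y| ≤ 2 * β * l1 z := by
  rw [D_vadd, abs_le]
  have h1 := D_sub_D_le hw (z + x) (z + y) x y
  have h2 := D_sub_D_le hw x y (z + x) (z + y)
  rw [l1_sub_comm, l1_sub_comm y] at h2
  simp only [add_sub_cancel_right] at h1 h2
  constructor <;> linarith

-- The first event is a liminf condition, unaffected by the bounded change that any lattice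
-- translation causes, so ergodicity of the full action decides it. The signs `σ = 1` and `σ = -1`
-- serve the lower and the upper rate.
omit [IsProbabilityMeasure P] in
theorem Admissible.rate_dichotomy (hP : Admissible P)
    (hβ : ∀ᵐ w ∂P, ∀ e : Edge, (w e : ℝ) ≤ β) (σ η : ℝ) (z : Z2) :
    (∀ᵐ w ∂P, ∀ k : ℕ, ∃ᶠ n : ℕ in atTop, σ * D w 0 (n • z) ≤ n * (η + 1 / (k + 1))) ∨
      ∀ᵐ w ∂P, ∀ᶠ n : ℕ in atTop, n * η < σ * D w 0 (n • z) := by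
  have hmeas : MeasurableSet {w : Weights | ∀ k : ℕ, ∃ᶠ n : ℕ in atTop,
      σ * D w 0 (n • z) ≤ n * (η + 1 / (k + 1))} := by
    rw [Set.ofPred_forall]
    exact .iInter fun k => measurableSet_frequently
      (s := fun n : ℕ => {w | σ * D w 0 (n • z) ≤ n * (η + 1 / (k + 1))})
      fun n => measurableSet_le ((measurable_D _ _).const_mul _) measurable_const
  refine (hP.ae_or_ae_not hmeas fun y => ?_).imp_right fun h => ?_
  · filter_upwards [hβ] with w hw
    have hC : ∀ n : ℕ, |σ * D (y +ᵥ w) 0 (n • z) - σ * D w 0 (n • z)| ≤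
        |σ| * (2 * β * l1 y) := fun n => by
      rw [← mul_sub, abs_mul]
      exact mul_le_mul_of_nonneg_left (abs_D_vadd_sub_le hw _ _ _) (abs_nonneg σ)
    exact ⟨forall_frequently_le_of_abs_sub_le hC,
      forall_frequently_le_of_abs_sub_le fun n => by rw [abs_sub_comm]; exact hC n⟩
  · filter_upwards [h] with w hw
    push Not at hw
    obtain ⟨k, hk⟩ := hw
    filter_upwards [hk] with n hn
    refine lt_of_le_of_lt ?_ hn
    have : (0 : ℝ) < 1 / (k + 1) := by positivity
    gcongr
    linarith

theorem D_subadditive (w : Weights) (z : Z2) (m n : ℕ) :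
    D w 0 ((m + n) • z) ≤ D w 0 (m • z) +
      D ((fun w : Weights => z +ᵥ w)^[m] w) 0 (n • z) := by
  rw [iterate_vadd, D_vadd, add_zero, add_nsmul]
  exact D_triangle w _ _ _

theorem Admissible.tendsto_direction (hP : Admissible P)
    (hβ : ∀ᵐ w ∂P, ∀ e : Edge, (w e : ℝ) ≤ β) {z : Z2} {r : ℝ}
    (hr : Tendsto (fun n : ℕ => meanD P (n • z) / n) atTop (𝓝 r)) :
    ∀ᵐ w ∂P, Tendsto (fun n : ℕ => D w 0 (n • z) / n) atTop (𝓝 r) := by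
  have hT := hP.measurePreserving z
  have ham : ∀ n : ℕ, Measurable fun w => D w 0 (n • z) := fun n => measurable_D _ _
  have hsub := fun m n w => D_subadditive w z m n
  have ha0 : ∀ w : Weights, D w 0 (0 • z) ≤ 0 := fun w => by rw [zero_smul, D_self]
  have hK : ∀ᵐ w ∂P, D w 0 (1 • z) ≤ β * l1 (0 - 1 • z) := hβ.mono fun w hw => D_le hw _ _
  -- The Fekete limit is the infimum of the quotients.
  have hrate : ∀ N : ℕ, N * r ≤ meanD P (N • z) := fun N => by
    have hs : Subadditive fun n : ℕ => meanD P (n • z) := fun m n => by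
      simp only [add_nsmul]
      exact hP.meanD_add_le hβ _ _
    have hbdd : BddBelow (Set.range fun n : ℕ => meanD P (n • z) / n) :=
      ⟨0, by
        rintro _ ⟨n, rfl⟩
        exact div_nonneg (meanD_nonneg _) (Nat.cast_nonneg n)⟩
    rcases N.eq_zero_or_pos with rfl | hN
    · simpa using meanD_nonneg _
    · have h1 := hs.lim_le_div hbdd hN.ne'
      rw [tendsto_nhds_unique (hs.tendsto_lim hbdd) hr, le_div_iff₀ (by positivity)] at h1
      linarith
  -- Otherwise almost every orbit shows a rate at most `η' < r` at some time, and
  -- `rate_le_of_subadditive` with probability one reads `r ≤ η'`.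
  have lower : ∀ η < r, ∀ᵐ w ∂P, ∀ᶠ n : ℕ in atTop, n * η < 1 * D w 0 (n • z) := fun η hη => by
    refine (hP.rate_dichotomy hβ 1 η z).resolve_left fun h => ?_
    obtain ⟨η', h1, h2⟩ := exists_between hη
    have hE : ∀ᵐ w ∂P, ∃ n : ℕ, 1 ≤ n ∧ D w 0 (n • z) ≤ n * η' := by
      filter_upwards [h] with w hw
      obtain ⟨k, hk⟩ := exists_nat_one_div_lt (sub_pos.2 h1)
      obtain ⟨n, hn, hn1⟩ := ((hw k).and_eventually (eventually_ge_atTop 1)).exists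
      refine ⟨n, hn1, ?_⟩
      rw [one_mul] at hn
      refine hn.trans ?_
      gcongr
      linarith
    have hη0 : 0 ≤ η' := by
      obtain ⟨w, n, hn1, hn⟩ := hE.exists
      have h3 := (D_nonneg w 0 (n • z)).trans hn
      have : (0 : ℝ) < n := by positivity
      exact nonneg_of_mul_nonneg_right h3 this
    have := rate_le_of_subadditive hT ham hsub ha0 (ae_of_all _ fun w n => D_nonneg w 0 (n • z))
      (hK.mono fun w hw => hw.trans (le_max_left _ η')) hη0 (le_max_right _ _) hrate
    rw [measureReal_eq_one_of_ae hE] at this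
    linarith
  -- Otherwise rates of at least `η'` recur almost surely, forcing `η'' ≤ meanD P (k • z) / k` for
  -- all `k ≥ 1`, although the limit is `r < η''`.
  have upper : ∀ η > r, ∀ᵐ w ∂P, ∀ᶠ n : ℕ in atTop, n * (-η) < (-1) * D w 0 (n • z) :=
    fun η hη => by
    refine (hP.rate_dichotomy hβ (-1) (-η) z).resolve_left fun h => ?_
    obtain ⟨η', h1, h2⟩ := exists_between hη
    obtain ⟨η'', h3, h4⟩ := exists_between h1
    have hfr : ∀ᵐ w ∂P, ∃ᶠ n : ℕ in atTop, n * η' ≤ D w 0 (n • z) := by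
      filter_upwards [h] with w hw
      obtain ⟨k, hk⟩ := exists_nat_one_div_lt (sub_pos.2 h2)
      refine (hw k).mono fun n hn => ?_
      have : (n : ℝ) * η' ≤ n * (η - 1 / (k + 1)) := by
        gcongr
        linarith
      linarith
    have hk : ∀ k : ℕ, 1 ≤ k → η'' ≤ meanD P (k • z) / k := fun k hk => by
      rw [le_div_iff₀ (by positivity), mul_comm]
      exact le_integral_of_frequently hT ham hsub ha0 (fun n w => D_nonneg w 0 (n • z)) hK h4
        hfr hk
    exact absurd (ge_of_tendsto hr ((eventually_ge_atTop 1).mono hk)) (not_le.2 h3)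
  have H := ae_all_iff.2 fun k : ℕ =>
    (lower (r - 1 / (k + 1)) (by have : (0 : ℝ) < 1 / (k + 1) := by positivity
                                 linarith)).and
    (upper (r + 1 / (k + 1)) (by have : (0 : ℝ) < 1 / (k + 1) := by positivity
                                 linarith))
  filter_upwards [H] with w hw
  rw [Metric.tendsto_nhds]
  intro ε hε
  obtain ⟨k, hk⟩ := exists_nat_one_div_lt hε
  filter_upwards [(hw k).1, (hw k).2, eventually_ge_atTop 1] with n h1 h2 hn
  have hn0 : (0 : ℝ) < n := by positivity
  refine lt_of_le_of_lt ?_ hk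
  rw [Real.dist_eq, abs_le]
  constructor
  · rw [le_sub_iff_add_le, le_div_iff₀ hn0]
    linarith
  · rw [sub_le_iff_le_add, div_le_iff₀ hn0]
    linarith

/-! ### Uniformity in the starting point -/

theorem nonempty_Icc_neg (n : ℕ) : (Finset.Icc (-(n : ℤ)) n).Nonempty := ⟨0, by simp⟩

/-- The maximum of `F n` over the translates by the multiples `j e`, `|j| ≤ n`. -/
noncomputable def lineSup (e : Z2) (F : ℕ → Weights → ℝ) (n : ℕ) (w : Weights) : ℝ :=
  (Finset.Icc (-(n : ℤ)) n).sup' (nonempty_Icc_neg n) fun j => F n ((j • e) +ᵥ w)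

theorem le_lineSup {e : Z2} (F : ℕ → Weights → ℝ) {n : ℕ} (w : Weights) {j : ℤ}
    (hj : -(n : ℤ) ≤ j ∧ j ≤ n) : F n ((j • e) +ᵥ w) ≤ lineSup e F n w :=
  Finset.le_sup' (fun j : ℤ => F n ((j • e) +ᵥ w)) (Finset.mem_Icc.2 hj)

/-- A family of measurable error functions on weight configurations that are Lipschitz along
translations and asymptotically small. -/
structure IsSmallError (P : Measure Weights) (C : ℝ) (F : ℕ → Weights → ℝ) : Prop where
  measurable : ∀ n, Measurable (F n)
  lipschitz : ∀ᵐ w ∂P, ∀ n z, F n w ≤ F n (z +ᵥ w) + C * l1 z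
  small : ∀ᵐ w ∂P, ∀ ε > 0, ∀ᶠ n : ℕ in atTop, F n w ≤ ε * n

/-- Smallness follows from `ae_eventually_forall_iterate_le` in the directions `e` and `-e`. Since
translations commute, the Lipschitz constant survives and the operation can be iterated. -/
theorem IsSmallError.lineSup {C : ℝ} {F : ℕ → Weights → ℝ} (hP : Admissible P) (hC : 0 ≤ C)
    (hF : IsSmallError P C F) (e : Z2) : IsSmallError P C (lineSup e F) where
  measurable n := by
    convert Finset.measurable_sup' (nonempty_Icc_neg n)
      (f := fun j w => F n ((j • e) +ᵥ w))
      fun j _ => (hF.measurable n).comp (measurable_vadd (j • e)) using 1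
    ext w
    rw [DualFPP.lineSup, Finset.sup'_apply]
  lipschitz := by
    have H := ae_all_iff.2 fun j : ℤ =>
      (hP.measurePreserving (j • e)).quasiMeasurePreserving.ae hF.lipschitz
    filter_upwards [H] with w hw n z
    refine Finset.sup'_le _ _ fun j hj => (hw j n z).trans ?_
    rw [vadd_vadd', add_comm (j • e) z, ← vadd_vadd']
    gcongr
    exact le_lineSup F _ (Finset.mem_Icc.1 hj)
  small := by
    have half : ∀ d : Z2, ∀ᵐ w ∂P, ∀ ε > 0, ∀ᶠ n : ℕ in atTop, ∀ j ≤ n,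
        F n ((j • d) +ᵥ w) ≤ ε * n := fun d => by
      -- The added 1 keeps the constant positive when `C * l1 d = 0`.
      have := ae_eventually_forall_iterate_le (hP.measurePreserving d) hF.measurable
        (C := C * l1 d + 1) (by linarith [mul_nonneg hC (l1_nonneg d)])
        (hF.lipschitz.mono fun w hw n => by linarith [hw n d]) hF.small
      simpa only [iterate_vadd] using this
    filter_upwards [half e, half (-e)] with w h1 h2 ε hε
    filter_upwards [h1 ε hε, h2 ε hε] with n hn1 hn2
    refine Finset.sup'_le _ _ fun j hj => ?_
    obtain ⟨hj1, hj2⟩ := Finset.mem_Icc.1 hj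
    obtain ⟨m, rfl | rfl⟩ := j.eq_nat_or_neg
    · simpa using hn1 m (by omega)
    · simpa using hn2 m (by omega)

theorem box_nonempty' (n : ℕ) : (box n).Nonempty := ⟨0, by simp [box, Pi.le_def]⟩

/-- The maximal deviation of `D(0,y)` from `ρ(y)` over the box of radius `n`. -/
noncomputable def originError (ρ : (Fin 2 → ℝ) → ℝ) (n : ℕ) (w : Weights) : ℝ :=
  (box n).sup' (box_nonempty' n) fun y => |D w 0 y - ρ (toR2 y)|

theorem toR2_sub (x y : Z2) : toR2 (x - y) = toR2 x - toR2 y := by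
  ext; simp [toR2]

theorem toR2_neg (x : Z2) : toR2 (-x) = -toR2 x := by
  ext; simp [toR2]

-- In the endpoint, `D` and `ρ` are each `β`-Lipschitz, which turns limits in single directions into
-- uniform smallness.
omit [IsProbabilityMeasure P] in
theorem isSmallError_originError (hβ : ∀ᵐ w ∂P, ∀ e : Edge, (w e : ℝ) ≤ β) (hβ0 : 0 ≤ β)
    {ρ : Seminorm ℝ (Fin 2 → ℝ)} (hρ : ∀ x, ρ x ≤ β * ∑ i, |x i|)
    (hlim : ∀ᵐ w ∂P, ∀ x : Z2, Tendsto (fun n : ℕ => D w 0 (n • x) / n) atTop (𝓝 (ρ (toR2 x)))) :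
    IsSmallError P (2 * β) (originError ρ) where
  measurable n := by
    convert Finset.measurable_sup' (box_nonempty' n) (f := fun y w => |D w 0 y - ρ (toR2 y)|)
      fun y _ => ((measurable_D 0 y).sub_const _).abs using 1
    ext w
    simp [originError]
  lipschitz := by
    filter_upwards [hβ] with w hw n z
    refine Finset.sup'_le _ _ fun y hy => ?_
    have h1 : |D (z +ᵥ w) 0 y - ρ (toR2 y)| ≤ originError ρ n (z +ᵥ w) :=
      Finset.le_sup' (fun y => |D (z +ᵥ w) 0 y - ρ (toR2 y)|) hy
    have h2 := abs_D_vadd_sub_le hw z 0 y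
    have h3 := abs_sub_le (D w 0 y) (D (z +ᵥ w) 0 y) (ρ (toR2 y))
    rw [abs_sub_comm (D w 0 y) (D (z +ᵥ w) 0 y)] at h3
    linarith
  small := by
    filter_upwards [hβ, hlim] with w hw hl ε hε
    have hlip : ∀ x y : Z2, |(D w 0 x - ρ (toR2 x)) - (D w 0 y - ρ (toR2 y))| ≤
        2 * β * l1 (x - y) := fun x y => by
      have h1 := D_sub_D_le hw 0 x 0 y
      have h2 := D_sub_D_le hw 0 y 0 x
      rw [l1_sub_comm y] at h2
      rw [sub_self, l1_zero] at h1 h2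
      have h3 : |ρ (toR2 x) - ρ (toR2 y)| ≤ β * l1 (x - y) := by
        refine (abs_sub_map_le_sub ρ _ _).trans ?_
        rw [← toR2_sub]
        exact hρ _
      rw [abs_le] at h3 ⊢
      constructor <;> linarith
    have hdir : ∀ z : Z2, Tendsto (fun n : ℕ => (D w 0 (n • z) - ρ (toR2 (n • z))) / n) atTop
        (𝓝 0) := fun z => by
      have h1 := (hl z).sub_const (ρ (toR2 z))
      rw [sub_self] at h1
      refine h1.congr' ?_
      filter_upwards [eventually_ge_atTop 1] with n hn
      have hn0 : (n : ℝ) ≠ 0 := by positivity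
      have h2 : toR2 (n • z) = (n : ℝ) • toR2 z := by ext; simp [toR2]
      rw [h2, map_smul_eq_mul, Real.norm_natCast]
      field_simp
    filter_upwards [eventually_forall_box_abs_le (by positivity) hlip hdir hε] with n hn
    exact Finset.sup'_le _ _ hn

/-- `D w x y` is the distance from the origin to `y - x` in the weights translated by `x`. The
difference lies in the box of radius `2 * n`, and `x` is reached along the two axes, so two nested
line suprema dominate the error. -/
theorem Admissible.tendsto_maxError (hP : Admissible P)
    (hβ : ∀ᵐ w ∂P, ∀ e : Edge, (w e : ℝ) ≤ β) (hβ0 : 0 ≤ β)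
    {ρ : Seminorm ℝ (Fin 2 → ℝ)} (hρ : ∀ x, ρ x ≤ β * ∑ i, |x i|)
    (hlim : ∀ᵐ w ∂P, ∀ x : Z2, Tendsto (fun n : ℕ => D w 0 (n • x) / n) atTop (𝓝 (ρ (toR2 x)))) :
    ∀ᵐ w ∂P, Tendsto (fun n : ℕ => maxError w ρ n) atTop (𝓝 0) := by
  have hC : 0 ≤ 2 * β := by positivity
  have hF := ((isSmallError_originError hβ hβ0 hρ hlim).lineSup hP hC ![1, 0]).lineSup hP hC ![0, 1]
  filter_upwards [hF.small] with w hw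
  have hbound : ∀ (n : ℕ) (x y : Z2), x ∈ box n → y ∈ box n → |D w x y - ρ (toR2 (x - y))| ≤
      lineSup ![0, 1] (lineSup ![1, 0] (originError ρ)) (2 * n) w := fun n x y hx hy => by
    simp only [box, Finset.mem_Icc, Pi.le_def] at hx hy
    have hyx : y - x ∈ box (2 * n) := by
      simp only [box, Finset.mem_Icc, Pi.le_def, Pi.sub_apply]
      push_cast
      constructor <;> intro i <;> linarith [hx.1 i, hx.2 i, hy.1 i, hy.2 i]
    have hj : ∀ i, -((2 * n : ℕ) : ℤ) ≤ x i ∧ x i ≤ ((2 * n : ℕ) : ℤ) := fun i => by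
      have := hx.1 i
      have := hx.2 i
      push_cast
      constructor <;> linarith
    have h1 := le_lineSup (e := ![0, 1]) (lineSup ![1, 0] (originError ρ)) w (hj 1)
    have h2 := le_lineSup (e := ![1, 0]) (originError ρ) ((x 1 • (![0, 1] : Z2)) +ᵥ w) (hj 0)
    have hsum : x 1 • (![0, 1] : Z2) + x 0 • (![1, 0] : Z2) = x := by
      ext i; fin_cases i <;> simp
    rw [vadd_vadd', hsum] at h2
    have h3 : |D (x +ᵥ w) 0 (y - x) - ρ (toR2 (y - x))| ≤ originError ρ (2 * n) (x +ᵥ w) :=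
      Finset.le_sup' (fun y => |D (x +ᵥ w) 0 y - ρ (toR2 y)|) hyx
    rw [D_vadd, add_zero, add_sub_cancel, ← neg_sub x y, toR2_neg, map_neg_eq_map] at h3
    exact h3.trans (h2.trans h1)
  rw [Metric.tendsto_nhds]
  intro ε hε
  -- At scale `2 * n`, the tolerance `ε / 4` becomes `ε / 2 * n`.
  have hev := (tendsto_id.const_mul_atTop' (two_pos : (0 : ℕ) < 2)).eventually
    (hw (ε / 4) (by positivity))
  filter_upwards [hev, eventually_ge_atTop 1] with n hn hn1
  have hn0 : (0 : ℝ) < n := by positivity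
  simp only [id] at hn
  push_cast at hn
  have h0 : 0 ≤ maxError w ρ n := by
    obtain ⟨p, hp⟩ := box_nonempty n
    exact (show 0 ≤ |D w p.1 p.2 - ρ (toR2 (p.1 - p.2))| / n by positivity).trans
      (Finset.le_sup' (fun p : Z2 × Z2 => |D w p.1 p.2 - ρ (toR2 (p.1 - p.2))| / (n : ℝ)) hp)
  rw [Real.dist_eq, sub_zero, abs_of_nonneg h0]
  refine lt_of_le_of_lt (Finset.sup'_le _ _ (a := ε / 2) fun p hp => ?_) (by linarith)
  obtain ⟨hx, hy⟩ := Finset.mem_product.1 hp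
  rw [div_le_iff₀ hn0]
  linarith [hbound n p.1 p.2 hx hy]

theorem Admissible.exists_norm (hP : Admissible P) :
    ∃ ρ : Seminorm ℝ (Fin 2 → ℝ), IsNorm ρ ∧
      (∀ᵐ w ∂P, Tendsto (fun n : ℕ => maxError w ρ n) atTop (𝓝 0)) ∧
      (∀ᵐ w ∂P, ∀ x : Z2, Tendsto (fun n : ℕ => D w 0 (n • x) / n) atTop (𝓝 (ρ (toR2 x)))) ∧
      (∀ a b : ℝ, (∀ e : Edge, ∀ᵐ w ∂P, (w e : ℝ) ∈ Set.Icc a b) →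
        ∀ x : Fin 2 → ℝ, a * ∑ i, |x i| ≤ ρ x ∧ ρ x ≤ b * ∑ i, |x i|) := by
  obtain ⟨α, β, hα, hαβ⟩ := hP.exists_bounds
  have hβ : ∀ᵐ w ∂P, ∀ e : Edge, (w e : ℝ) ≤ β := hαβ.mono fun w hw e => (hw e).2
  have hmean : ∀ a b : ℝ, (∀ᵐ w ∂P, ∀ e : Edge, a ≤ w e ∧ (w e : ℝ) ≤ b) →
      ∀ x : Z2, a * l1 x ≤ meanD P x ∧ meanD P x ≤ b * l1 x := fun a b hab x => by
    have hl : l1 (0 - x) = l1 x := by rw [zero_sub, l1_neg]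
    constructor
    · have := integral_mono_ae (integrable_const (a * l1 x)) (integrable_D hβ 0 x)
        (hab.mono fun w hw => by rw [← hl]; exact le_D (fun e => (hw e).1) 0 x)
      simpa [meanD] using this
    · have := integral_mono_ae (integrable_D hβ 0 x) (integrable_const (b * l1 x))
        (hab.mono fun w hw => by rw [← hl]; exact D_le (fun e => (hw e).2) 0 x)
      simpa [meanD] using this
  have hβ0 : 0 ≤ β := by
    obtain ⟨w, hw⟩ := hαβ.exists
    have := hw ⟨s(0, ![1, 0]), by change ∑ i, _ = _; simp⟩
    linarith [this.1, this.2]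
  obtain ⟨ρ, hρ⟩ := exists_seminorm_tendsto (hP.meanD_add_le hβ) hP.meanD_neg meanD_nonneg
    fun x => (hmean α β hαβ x).2
  have hρab : ∀ a b : ℝ, (∀ᵐ w ∂P, ∀ e : Edge, a ≤ w e ∧ (w e : ℝ) ≤ b) →
      ∀ x : Fin 2 → ℝ, a * ∑ i, |x i| ≤ ρ x ∧ ρ x ≤ b * ∑ i, |x i| := fun a b hab x => by
    have hfl : ∀ n : ℕ, l1Dist (floorVec ((n : ℝ) • x)) ((n : ℝ) • x) ≤ 2 :=
      fun n => l1Dist_floorVec _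
    have h1 := hρ x _ 2 hfl
    have h2 := tendsto_l1_div hfl
    constructor
    · refine le_of_tendsto_of_tendsto' (h2.const_mul a) h1 fun n => ?_
      rw [← mul_div_assoc]
      gcongr
      exact (hmean a b hab _).1
    · refine le_of_tendsto_of_tendsto' h1 (h2.const_mul b) fun n => ?_
      rw [← mul_div_assoc]
      gcongr
      exact (hmean a b hab _).2
  have hlim : ∀ᵐ w ∂P, ∀ x : Z2,
      Tendsto (fun n : ℕ => D w 0 (n • x) / n) atTop (𝓝 (ρ (toR2 x))) :=
    ae_all_iff.2 fun x => hP.tendsto_direction hβ <| hρ (toR2 x) (fun n => n • x) 0 fun n => by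
      simp [l1Dist, toR2]
  refine ⟨ρ, fun x hx => ?_, hP.tendsto_maxError hβ hβ0 (fun x => (hρab α β hαβ x).2) hlim, hlim,
    fun a b hab => hρab a b (ae_all_iff.2 hab)⟩
  -- Positivity of `α` makes the seminorm definite.
  have h1 := (hρab α β hαβ x).1
  rw [hx] at h1
  have h2 : ∑ i, |x i| = 0 := le_antisymm (by nlinarith)
    (Finset.sum_nonneg fun _ _ => abs_nonneg _)
  ext i
  exact abs_eq_zero.1
    ((Finset.sum_eq_zero_iff_of_nonneg fun _ _ => abs_nonneg _).1 h2 i (Finset.mem_univ i))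

end DualFPP

theorem theorem1p3 (P : Measure Weights) [IsProbabilityMeasure P] (hP : Admissible P) :
    ∃ ρ : Seminorm ℝ (Fin 2 → ℝ), IsNorm ρ ∧
      (∀ᵐ w ∂P, Tendsto (fun n : ℕ => maxError w ρ n) atTop (𝓝 0)) ∧
      (∀ᵐ w ∂P, ∀ x : Z2, Tendsto (fun n : ℕ => D w 0 (n • x) / n) atTop (𝓝 (ρ (toR2 x)))) ∧
      (∀ a b : ℝ, (∀ e : Edge, ∀ᵐ w ∂P, (w e : ℝ) ∈ Set.Icc a b) →
        ∀ x : Fin 2 → ℝ, a * ∑ i, |x i| ≤ ρ x ∧ ρ x ≤ b * ∑ i, |x i|) :=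
  hP.exists_norm
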